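/- For a set $P\subseteq\mathbb{R}^n$, an \emph{extended formulation} of size $k$ consists of a polyhedron $Q=\{z\in\mathbb{R}^m \mid Cz\le c,\ Dz=d\}$, where $m$ is arbitrary, $C$ has exactly $k$ rows and $D$ has any finite number of rows, together with a linear map $p:\mathbb{R}^m\to\mathbb{R}^n$ such that $p(Q)=P$. The \emph{extension complexity} $\mathrm{xc}(P)$ is the smallest size of an extended formulation of $P$. Let $n\ge 0$ be an integer, let $X\subseteq\{0,1\}^n$ be non-empty, and put $r:=\mathrm{xc}(\mathrm{conv}(X))$ and $\Delta:=(\sqrt{n+1})^{\,n+1}$. Then there are matrices $\bar A\in\mathbb{Z}^{(n+r)\times n}$ and $\bar U\in\mathbb{R}^{(n+r)\times r}$ and a vector $\bar b\in\mathbb{Z}^{n+r}$ such that every entry of $\bar U$ is a non-negative integer multiple of $\frac{1}{4r(n+r)\Delta}$, all entries of $\bar A$, $\bar U$ and $\bar b$ have absolute value at most $\Delta$, and \[ X=\Big\{x\in\{0,1\}^n \ \Big|\ \exists\, y\in[0,\Delta]^r:\ \|\bar A x+\bar U y-\bar b\|_\infty\le \tfrac{1}{4(n+r)}\Big\}. \]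 (If $r=0$, then $\bar U$ has no entries and the condition on them is void; if $n=0$, then $r=0$, there are no rows, and the norm condition is regarded as satisfied.) -/

import Mathlib

open scoped Matrix

/-- The 0/1 points of `ℝ^n`. -/
def cube01 (n : ℕ) : Set (Fin n → ℝ) := {x | ∀ i, x i = 0 ∨ x i = 1}

/-- `P ⊆ ℝ^n` has an extended formulation of size `k`: a polyhedron
`Q = {z ∈ ℝ^m | C z ≤ c, D z = d}` where `C` has `k` rows (the number of equations is free),
and a linear map `p : ℝ^m → ℝ^n` with `p(Q) = P`. -/
def HasExtendedFormulation {n : ℕ} (P : Set (Fin n → ℝ)) (k : ℕ) : Prop :=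
  ∃ (m l : ℕ) (C : Matrix (Fin k) (Fin m) ℝ) (c : Fin k → ℝ)
    (D : Matrix (Fin l) (Fin m) ℝ) (d : Fin l → ℝ) (p : (Fin m → ℝ) →ₗ[ℝ] (Fin n → ℝ)),
    p '' {z | C *ᵥ z ≤ c ∧ D *ᵥ z = d} = P

/-- The extension complexity: the smallest size of an extended formulation of `P`.
The set below is nonempty for the polytopes considered here
(see `exists_hasExtendedFormulation`), so the infimum is an attained minimum. -/
noncomputable def xc {n : ℕ} (P : Set (Fin n → ℝ)) : ℕ :=
  sInf {k | HasExtendedFormulation P k}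

/-- The convex hull of a set of 0/1 points has an extended formulation. -/
theorem exists_hasExtendedFormulation {n : ℕ} (X : Set (Fin n → ℝ)) (hX : X ⊆ cube01 n) :
    ∃ k, HasExtendedFormulation (convexHull ℝ X) k := by
  have hfin : X.Finite := by
    refine (Set.Finite.pi' (t := fun _ : Fin n => ({0, 1} : Set ℝ))
      (fun _ => Set.toFinite _)).subset ?_
    intro x hx i
    simpa using hX hx i
  have : Fintype X := hfin.fintype
  let e := Fintype.equivFin X
  let v : Fin (Fintype.card X) → (Fin n → ℝ) := fun i => (e.symm i : Fin n → ℝ)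
  have hv : Set.range v = X := by
    ext x
    constructor
    · rintro ⟨i, rfl⟩
      exact (e.symm i).2
    · intro hx
      exact ⟨e ⟨x, hx⟩, by simp [v]⟩
  refine ⟨Fintype.card X, Fintype.card X, 1, -1, 0, fun _ _ => 1, fun _ => 1,
    Fintype.linearCombination ℝ v, ?_⟩
  have hQ : {z : Fin (Fintype.card X) → ℝ |
      (-1 : Matrix (Fin (Fintype.card X)) (Fin (Fintype.card X)) ℝ) *ᵥ z ≤ 0 ∧
      (fun _ _ => 1 : Matrix (Fin 1) (Fin (Fintype.card X)) ℝ) *ᵥ z = fun _ => 1}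
      = stdSimplex ℝ (Fin (Fintype.card X)) := by
    ext z
    simp [stdSimplex, Pi.le_def, funext_iff, Matrix.neg_mulVec, Matrix.mulVec,
      dotProduct]
  rw [hQ, ← convexHull_rangle_single_eq_stdSimplex, LinearMap.image_convexHull, ← Set.range_comp]
  refine congrArg _ (Eq.trans (congrArg Set.range ?_) hv)
  ext i : 1
  simp [Fintype.linearCombination_apply, Pi.single_apply]

/-- `Δ(n) = (√(n+1))^(n+1)`. -/
noncomputable def Delta (n : ℕ) : ℝ := √((n : ℝ) + 1) ^ (n + 1)

/-! Each 0/1 point outside `X` violates an integral inequality `a·x ≤ b` that is valid and tight on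
`X`; Cramer's rule and Hadamard's bound keep its coefficients within `Δ` (`exists_int_separating`).
By Farkas, an extended formulation of size `r` turns these inequalities into equations `a·x + u·y(x)
= b` on `X` with `u, y(x) ≥ 0`; tightness removes the constant term. Slacks are at most `Δ²`, so
rescaling each of the `r` coordinates puts both factors into `[0, Δ]`.

Among the vectors `(a, u)` of dimension `n + r`, at most `n + r` with maximal determinant in their
span express all others with coefficients in `[-1, 1]`. Only these rows are kept, with `u` rounded
down to the grid. Rounding costs at most `1/(4(n+r))` per row, so points of `X` survive. If `x ∉ X`
survived with some `y`, every unrounded row would have error at most `1/(2(n+r))`, hence the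
equation separating `x` would have error at most `1/2`. But integrality and `u·y ≥ 0` force an error
of at least `1`. -/

/-! ### Linear programming duality -/

/-- Farkas' lemma for finitely many functionals on an arbitrary real vector space. -/
theorem exists_nonneg_combination_of_le {V : Type*} [AddCommGroup V] [Module ℝ V] {k : ℕ}
    (f : Fin k → V →ₗ[ℝ] ℝ) (g : V →ₗ[ℝ] ℝ) (h : ∀ x, (∀ i, f i x ≤ 0) → g x ≤ 0) :
    ∃ c : Fin k → ℝ, (∀ i, 0 ≤ c i) ∧ ∀ x, g x = ∑ i, c i * f i x := by
  induction k generalizing g with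
  | zero =>
    refine ⟨0, fun i => le_rfl, fun x => ?_⟩
    have h1 := h x (fun i => i.elim0)
    have h2 := h (-x) (fun i => i.elim0)
    simp only [map_neg] at h2
    simp only [Finset.univ_eq_empty, Finset.sum_empty]
    linarith
  | succ k ih =>
    by_cases hg : ∀ x, (∀ i : Fin k, f i.succ x ≤ 0) → g x ≤ 0
    · obtain ⟨c, hc, hcg⟩ := ih (fun i => f i.succ) g hg
      refine ⟨Fin.cons 0 c, fun i => ?_, fun x => ?_⟩
      · refine Fin.cases ?_ (fun j => ?_) i <;> simp [hc]
      · simp [Fin.sum_univ_succ, hcg]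
    · push Not at hg
      obtain ⟨x₀, hx₀, hgx₀⟩ := hg
      have hf : 0 < f 0 x₀ := by
        by_contra! hcon
        exact absurd (h x₀ (fun i => Fin.cases hcon hx₀ i)) (not_le.2 hgx₀)
      have hfne := hf.ne'
      -- Composing with the projection onto `ker (f 0)` along `x₀` eliminates `f 0`.
      obtain ⟨c, hc, hcg⟩ := ih (fun i => f i.succ - (f i.succ x₀ / f 0 x₀) • f 0)
        (g - (g x₀ / f 0 x₀) • f 0) (by
          intro x hx
          have key := h (x - (f 0 x / f 0 x₀) • x₀) (by
            intro i
            refine Fin.cases ?_ (fun j => ?_) i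
            · simp [hfne]
            · have := hx j
              simp only [LinearMap.sub_apply, LinearMap.smul_apply, smul_eq_mul, map_sub,
                map_smul] at this ⊢
              convert this using 2
              ring)
          simp only [LinearMap.sub_apply, LinearMap.smul_apply, smul_eq_mul, map_sub,
            map_smul] at key ⊢
          convert key using 2
          ring)
      refine ⟨Fin.cons ((g x₀ - ∑ i, c i * f i.succ x₀) / f 0 x₀) c, fun i => ?_, fun x => ?_⟩
      · refine Fin.cases ?_ (fun j => ?_) i
        · have : ∑ i, c i * f i.succ x₀ ≤ 0 :=
            Finset.sum_nonpos fun i _ => mul_nonpos_of_nonneg_of_nonpos (hc i) (hx₀ i)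
          simp only [Fin.cons_zero]
          exact div_nonneg (by linarith) hf.le
        · simp [hc]
      · have := hcg x
        simp only [LinearMap.sub_apply, LinearMap.smul_apply, smul_eq_mul] at this
        rw [Fin.sum_univ_succ]
        simp only [Fin.cons_zero, Fin.cons_succ]
        have e : ∑ i, c i * (f i.succ x - f i.succ x₀ / f 0 x₀ * f 0 x)
            = ∑ i, c i * f i.succ x - (∑ i, c i * f i.succ x₀) / f 0 x₀ * f 0 x := by
          rw [Finset.sum_div, Finset.sum_mul, ← Finset.sum_sub_distrib]
          exact Finset.sum_congr rfl fun i _ => by ring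
        rw [e] at this
        rw [sub_div]
        linarith

/-- A linear inequality valid on a non-empty polyhedron has a slack that is a non-negative
combination of the slacks of the defining inequalities and a non-negative constant. -/
theorem exists_slack_eq_combination {k m l : ℕ} (C : Matrix (Fin k) (Fin m) ℝ) (c : Fin k → ℝ)
    (D : Matrix (Fin l) (Fin m) ℝ) (d : Fin l → ℝ) (h : (Fin m → ℝ) →ₗ[ℝ] ℝ) (β : ℝ)
    (hne : ∃ z, C *ᵥ z ≤ c ∧ D *ᵥ z = d)
    (hval : ∀ z, C *ᵥ z ≤ c → D *ᵥ z = d → h z ≤ β) :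
    ∃ (u : Fin k → ℝ) (ε : ℝ), (∀ i, 0 ≤ u i) ∧ 0 ≤ ε ∧
      ∀ z, D *ᵥ z = d → β - h z = ∑ i, u i * (c i - (C *ᵥ z) i) + ε := by
  -- Homogenization by a variable `t`: the cone is `D z = t d`, `C z ≤ t c`, `t ≥ 0`. The multiplier
  -- of `-t ≤ 0` becomes `ε`.
  let φ : (Fin m → ℝ) × ℝ →ₗ[ℝ] (Fin l → ℝ) :=
    D.mulVecLin ∘ₗ LinearMap.fst ℝ _ _ - (LinearMap.snd ℝ (Fin m → ℝ) ℝ).smulRight d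
  let K := LinearMap.ker φ
  let ψ : Fin k → (Fin m → ℝ) × ℝ →ₗ[ℝ] ℝ := fun i =>
    LinearMap.proj i ∘ₗ C.mulVecLin ∘ₗ LinearMap.fst ℝ _ _ - c i • LinearMap.snd ℝ (Fin m → ℝ) ℝ
  let g : (Fin m → ℝ) × ℝ →ₗ[ℝ] ℝ := h ∘ₗ LinearMap.fst ℝ _ _ - β • LinearMap.snd ℝ (Fin m → ℝ) ℝ
  let f : Fin (k + 1) → K →ₗ[ℝ] ℝ :=
    Fin.cons (-(LinearMap.snd ℝ (Fin m → ℝ) ℝ) ∘ₗ K.subtype) (fun i => ψ i ∘ₗ K.subtype)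
  obtain ⟨u, hu, hug⟩ := exists_nonneg_combination_of_le f (g ∘ₗ K.subtype) (by
    rintro ⟨⟨z, t⟩, hz⟩ hf
    have hD : D *ᵥ z = t • d := by
      simpa [K, φ, sub_eq_zero] using hz
    have ht : 0 ≤ t := by simpa [f] using hf 0
    have hC : ∀ i, (C *ᵥ z) i ≤ c i * t := fun i => by
      simpa [f, ψ] using hf i.succ
    change h z - β * t ≤ 0
    rcases ht.eq_or_lt with rfl | ht
    · by_contra! hpos
      obtain ⟨z₀, hz₀, hz₀'⟩ := hne
      have hhz : 0 < h z := by simpa using hpos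
      -- For `t = 0`, `z` is a recession direction; this step length would raise `h` to `β + 1`.
      set s := (β - h z₀ + 1) / h z with hs
      have hs0 : 0 ≤ s := div_nonneg (by linarith [hval z₀ hz₀ hz₀']) hhz.le
      have := hval (z₀ + s • z) (by
        intro i
        have h1 := hz₀ i
        have h2 := hC i
        simp only [Matrix.mulVec_add, Matrix.mulVec_smul, Pi.add_apply, Pi.smul_apply, smul_eq_mul]
        nlinarith) (by simp [Matrix.mulVec_add, Matrix.mulVec_smul, hz₀', hD])
      rw [map_add, map_smul, smul_eq_mul, hs, div_mul_cancel₀ _ hhz.ne'] at this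
      linarith
    · have := hval (t⁻¹ • z) (by
        intro i
        have := hC i
        simp only [Matrix.mulVec_smul, Pi.smul_apply, smul_eq_mul]
        rw [inv_mul_le_iff₀ ht]
        linarith) (by
          rw [Matrix.mulVec_smul, hD, smul_smul, inv_mul_cancel₀ ht.ne', one_smul])
      rw [map_smul, smul_eq_mul, inv_mul_le_iff₀ ht] at this
      linarith)
  refine ⟨fun i => u i.succ, u 0, fun i => hu _, hu _, fun z hz => ?_⟩
  have := hug ⟨(z, 1), by simp [K, φ, hz]⟩
  rw [Fin.sum_univ_succ] at this
  simp only [LinearMap.coe_comp, Function.comp_apply, Submodule.subtype_apply, g, f, ψ,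
    Fin.cons_zero, Fin.cons_succ, LinearMap.sub_apply, LinearMap.smul_apply, LinearMap.neg_apply,
    LinearMap.fst_apply, LinearMap.snd_apply, LinearMap.proj_apply, Matrix.mulVecLin_apply,
    smul_eq_mul, mul_one] at this
  have e : ∑ i : Fin k, u i.succ * (c i - (C *ᵥ z) i)
      = -∑ i : Fin k, u i.succ * ((C *ᵥ z) i - c i) := by
    rw [← Finset.sum_neg_distrib]
    exact Finset.sum_congr rfl fun i _ => by ring
  rw [e]
  linarith

/-! ### Determinants: Hadamard's bound and maximal subfamilies -/

/-- Hadamard's inequality. -/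
theorem abs_det_le_prod_norm_row {N : ℕ} (M : Matrix (Fin N) (Fin N) ℝ) :
    |M.det| ≤ ∏ i, ‖WithLp.toLp 2 (M i)‖ := by
  have : Fact (Module.finrank ℝ (EuclideanSpace ℝ (Fin N)) = N) := ⟨by simp⟩
  let b := EuclideanSpace.basisFun (Fin N) ℝ
  have h := b.toBasis.orientation.abs_volumeForm_apply_le (fun i => WithLp.toLp 2 (M i))
  rw [b.toBasis.orientation.volumeForm_robust' b] at h
  convert h using 2
  rw [Module.Basis.det_apply, ← Matrix.det_transpose]
  congr 1

theorem abs_det_le_sqrt_pow {N : ℕ} (M : Matrix (Fin N) (Fin N) ℝ) (hM : ∀ i j, |M i j| ≤ 1) :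
    |M.det| ≤ √(N : ℝ) ^ N := by
  refine (abs_det_le_prod_norm_row M).trans ?_
  refine (Finset.prod_le_prod (fun _ _ => norm_nonneg _) (g := fun _ => √(N : ℝ)) ?_).trans ?_
  · intro i _
    rw [EuclideanSpace.norm_eq]
    refine Real.sqrt_le_sqrt ?_
    calc ∑ j, ‖M i j‖ ^ 2 ≤ ∑ j : Fin N, (1 : ℝ) :=
          Finset.sum_le_sum fun j _ => pow_le_one₀ (norm_nonneg _) (hM i j)
      _ = N := by simp
  · simp

/-- Every finite family of vectors has a subfamily, of size the dimension of its span,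
by which all its members are expressed with coefficients in `[-1, 1]`. -/
theorem exists_subfamily_coeff_le_one {E ι : Type*} [AddCommGroup E] [Module ℝ E]
    [Finite ι] (v : ι → E) :
    ∃ f : Fin (Module.finrank ℝ (Submodule.span ℝ (Set.range v))) → ι,
      ∀ l, ∃ c : Fin (Module.finrank ℝ (Submodule.span ℝ (Set.range v))) → ℝ,
        (∀ i, |c i| ≤ 1) ∧ v l = ∑ i, c i • v (f i) := by
  classical
  set W := Submodule.span ℝ (Set.range v)
  have : Module.Finite ℝ W := Module.Finite.span_of_finite ℝ (Set.finite_range v)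
  set k := Module.finrank ℝ W
  let b : Module.Basis (Fin k) ℝ W := Module.finBasis ℝ W
  let v' : ι → W := fun l => ⟨v l, Submodule.subset_span ⟨l, rfl⟩⟩
  have hspan : ⊤ ≤ Submodule.span ℝ (Set.range v') := by
    have := Submodule.span_span_coe_preimage (R := ℝ) (s := Set.range v)
    rw [top_le_iff, ← this]
    congr 1
    ext x
    simp only [Set.mem_range, Set.mem_preimage, v', Subtype.ext_iff]
  obtain ⟨s, hs, hsp, hli⟩ := exists_linearIndependent ℝ (Set.range v')
  let e₀ : Module.Basis s ℝ W := Module.Basis.mk hli (by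
    rw [Subtype.range_coe, hsp]; exact hspan)
  let e₁ : Module.Basis (Fin k) ℝ W := e₀.reindex (e₀.indexEquiv b)
  have hmem : ∀ i, ∃ l, v' l = e₁ i := fun i => by
    have : e₁ i ∈ s := by simp [e₁, e₀]
    exact hs this
  choose f₁ hf₁ using hmem
  have : Finite (Fin k → ι) := inferInstance
  have : Nonempty (Fin k → ι) := ⟨f₁⟩
  obtain ⟨f, hf⟩ := Finite.exists_max (fun f : Fin k → ι => |b.det (fun i => v' (f i))|)
  have hpos : 0 < |b.det (fun i => v' (f i))| := by
    refine lt_of_lt_of_le ?_ (hf f₁)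
    have : (fun i => v' (f₁ i)) = e₁ := funext hf₁
    rw [this, abs_pos]
    exact (b.isUnit_det e₁).ne_zero
  have hu : IsUnit (b.det (fun i => v' (f i))) := (abs_pos.1 hpos).isUnit
  obtain ⟨hli', hsp'⟩ := (Module.Basis.is_basis_iff_det b).2 hu
  let e : Module.Basis (Fin k) ℝ W := Module.Basis.mk hli' hsp'.ge
  have he : (e : Fin k → W) = fun i => v' (f i) := by simp [e]
  refine ⟨f, fun l => ⟨fun i => e.repr (v' l) i, fun i => ?_, ?_⟩⟩
  -- By Cramer's rule the coordinate is the ratio of the determinant after exchanging the `i`-th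
  -- vector for `v l` to the maximal one.
  · have h1 : e.repr (v' l) i = e.det (Function.update e i (v' l)) := by
      rw [Module.Basis.det_apply, Module.Basis.toMatrix_update, Module.Basis.toMatrix_self,
        ← Matrix.cramer_apply, Matrix.cramer_one]
      rfl
    have h2 : b.det (Function.update e i (v' l))
        = b.det e * e.det (Function.update e i (v' l)) := by
      conv_lhs => rw [AlternatingMap.eq_smul_basis_det e b.det]
      simp
    have h3 : (Function.update e i (v' l) : Fin k → W)
        = fun j => v' (Function.update f i l j) := by
      rw [he]
      ext j
      by_cases hj : j = i
      · subst hj; simp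
      · simp [hj]
    have h4 := hf (Function.update f i l)
    rw [← h3, h2, abs_mul, ← h1, he] at h4
    exact le_of_mul_le_mul_left (by linarith) hpos
  · have := e.sum_repr (v' l)
    rw [he] at this
    have := congrArg (Subtype.val) this
    rw [← show (v' l : E) = v l from rfl, ← this]
    simp [v']

/-! ### Separation with small integral coefficients -/

/-- A vector that weakly separates `v₀` from `V` can be chosen such that, together with `v₀`,
the members of `S` orthogonal to it span the whole space. -/
theorem exists_separating_basic {N : ℕ} (S V : Set (Fin N → ℝ)) (hS : S.Finite)
    (hVS : V ⊆ S) (hE : ∀ j, Pi.single j 1 ∈ S) (v₀ w₀ : Fin N → ℝ)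
    (hle : ∀ v ∈ V, w₀ ⬝ᵥ v ≤ 0) (htight : ∃ v ∈ V, w₀ ⬝ᵥ v = 0) (hpos : 0 < w₀ ⬝ᵥ v₀) :
    ∃ w : Fin N → ℝ, (∀ v ∈ V, w ⬝ᵥ v ≤ 0) ∧ (∃ v ∈ V, w ⬝ᵥ v = 0) ∧ 0 < w ⬝ᵥ v₀ ∧
      ∀ u : Fin N → ℝ, (∀ s ∈ S, w ⬝ᵥ s = 0 → u ⬝ᵥ s = 0) → u ⬝ᵥ v₀ = 0 → u = 0 := by
  classical
  let G : Set (Fin N → ℝ) := {w | (∀ v ∈ V, w ⬝ᵥ v ≤ 0) ∧ (∃ v ∈ V, w ⬝ᵥ v = 0) ∧ 0 < w ⬝ᵥ v₀}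
  let T : (Fin N → ℝ) → Finset (Fin N → ℝ) := fun w => hS.toFinset.filter (fun s => w ⬝ᵥ s = 0)
  have hfin : (T '' G).Finite :=
    (hS.toFinset.powerset.finite_toSet).subset (by
      rintro _ ⟨w, -, rfl⟩
      simp [T])
  -- Take `w` with an inclusion-maximal set of orthogonal members of `S`. A nonzero `u` would allow
  -- a move that enlarges this set.
  obtain ⟨t, ⟨w, hw, rfl⟩, hmax⟩ := hfin.exists_maximal ⟨_, w₀, ⟨hle, htight, hpos⟩, rfl⟩
  refine ⟨w, hw.1, hw.2.1, hw.2.2, fun u hu hu₀ => ?_⟩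
  by_contra hne
  obtain ⟨j, hj⟩ : ∃ j, u j ≠ 0 := by
    by_contra! h
    exact hne (funext h)
  let R := hS.toFinset.filter (fun s => u ⬝ᵥ s ≠ 0)
  have hR : R.Nonempty := ⟨Pi.single j 1, by simp [R, hE, hj]⟩
  -- The shortest move making a new member orthogonal, in either direction, cannot break an
  -- inequality on `V`.
  obtain ⟨s, hsR, hsmin⟩ := R.exists_min_image (fun s => |w ⬝ᵥ s / u ⬝ᵥ s|) hR
  have hsS : s ∈ S := by simp [R] at hsR; exact hsR.1
  have hsu : u ⬝ᵥ s ≠ 0 := by simp [R] at hsR; exact hsR.2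
  set τ := -(w ⬝ᵥ s / u ⬝ᵥ s) with hτ
  have hdot : ∀ x, (w + τ • u) ⬝ᵥ x = w ⬝ᵥ x + τ * (u ⬝ᵥ x) := fun x => by
    rw [add_dotProduct, smul_dotProduct, smul_eq_mul]
  have hkeep : ∀ x ∈ S, w ⬝ᵥ x = 0 → (w + τ • u) ⬝ᵥ x = 0 := fun x hx hx0 => by
    rw [hdot, hx0, hu x hx hx0]; simp
  have hzero : (w + τ • u) ⬝ᵥ s = 0 := by
    rw [hdot, hτ]; field_simp; ring
  have hG : w + τ • u ∈ G := by
    refine ⟨fun v hv => ?_, ?_, ?_⟩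
    · rw [hdot]
      by_cases huv : u ⬝ᵥ v = 0
      · rw [huv, mul_zero, add_zero]; exact hw.1 v hv
      · have h1 := hsmin v (by simp [R, hVS hv, huv])
        have h2 : |τ * (u ⬝ᵥ v)| ≤ |w ⬝ᵥ v| := by
          rw [abs_mul, hτ, abs_neg]
          calc _ ≤ |w ⬝ᵥ v / u ⬝ᵥ v| * |u ⬝ᵥ v| := by gcongr
            _ = |w ⬝ᵥ v| := by rw [← abs_mul, div_mul_cancel₀ _ huv]
        rw [abs_of_nonpos (hw.1 v hv)] at h2
        linarith [le_abs_self (τ * (u ⬝ᵥ v))]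
    · obtain ⟨v, hv, hv0⟩ := hw.2.1
      exact ⟨v, hv, hkeep v (hVS hv) hv0⟩
    · rw [hdot, hu₀]; simpa using hw.2.2
  have hsub : T w ≤ T (w + τ • u) := by
    intro x hx
    simp only [T, Finset.mem_filter, Set.Finite.mem_toFinset] at hx ⊢
    exact ⟨hx.1, hkeep x hx.1 hx.2⟩
  have hback := hmax ⟨_, hG, rfl⟩ hsub
  have hsT : s ∈ T w := hback (Finset.mem_filter.2 ⟨hS.mem_toFinset.2 hsS, hzero⟩)
  simp only [T, Finset.mem_filter, Set.Finite.mem_toFinset] at hsT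
  exact hsu (hu s hsT.1 hsT.2)

/-- If `w` is determined up to a factor by orthogonality to some members of `S`, then `w` solves a
non-singular system of linear equations with rows from `S` and `v₀`. -/
theorem exists_nonsingular_system {N : ℕ} (S : Set (Fin N → ℝ)) (v₀ w : Fin N → ℝ)
    (hpos : 0 < w ⬝ᵥ v₀)
    (hdet : ∀ u : Fin N → ℝ, (∀ s ∈ S, w ⬝ᵥ s = 0 → u ⬝ᵥ s = 0) → u ⬝ᵥ v₀ = 0 → u = 0) :
    ∃ (M : Matrix (Fin N) (Fin N) ℝ) (i₀ : Fin N), M.det ≠ 0 ∧ (∀ i, M i ∈ insert v₀ S) ∧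
      M *ᵥ w = Pi.single i₀ (w ⬝ᵥ v₀) := by
  classical
  set T : Set (Fin N → ℝ) := {s | s ∈ S ∧ w ⬝ᵥ s = 0}
  have hv₀ : v₀ ≠ 0 := by rintro rfl; simp at hpos
  have hli₀ : LinearIndepOn ℝ id ({v₀} : Set (Fin N → ℝ)) :=
    by simpa using hv₀
  obtain ⟨b, hbT, hvb, hTb, hli⟩ :=
    exists_linearIndepOn_id_extension hli₀ (Set.singleton_subset_iff.2 (Set.mem_insert v₀ T))
  have hspan : ⊤ ≤ Submodule.span ℝ b := by
    by_contra hlt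
    rw [top_le_iff] at hlt
    obtain ⟨φ, hφ, hker⟩ := Submodule.exists_le_ker_of_lt_top _ (lt_top_iff_ne_top.2 hlt)
    have hrep : ∀ x, φ x = (fun i => φ (Pi.single i 1)) ⬝ᵥ x := fun x => by
      conv_lhs => rw [pi_eq_sum_univ' x]
      simp [dotProduct, mul_comm]
    have h0 : ∀ x ∈ insert v₀ T, φ x = 0 := fun x hx => hker (hTb hx)
    have hz := hdet (fun i => φ (Pi.single i 1))
      (fun s hs hs0 => by rw [← hrep]; exact h0 s (Or.inr ⟨hs, hs0⟩))
      (by rw [← hrep]; exact h0 v₀ (Or.inl rfl))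
    refine hφ (LinearMap.ext fun x => ?_)
    rw [hrep, hz]; simp
  let e₀ : Module.Basis b ℝ (Fin N → ℝ) := Module.Basis.mk hli (by simpa using hspan)
  let e : Module.Basis (Fin N) ℝ (Fin N → ℝ) := e₀.reindex (e₀.indexEquiv (Pi.basisFun ℝ (Fin N)))
  let σ := e₀.indexEquiv (Pi.basisFun ℝ (Fin N))
  have he : ∀ i, e i = (σ.symm i : Fin N → ℝ) := fun i => by simp [e, e₀, σ]
  refine ⟨fun i => e i, σ ⟨v₀, hvb rfl⟩, ?_, fun i => ?_, ?_⟩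
  · have := ((Pi.basisFun ℝ (Fin N)).isUnit_det e).ne_zero
    rw [Module.Basis.det_apply, ← Matrix.det_transpose] at this
    exact this
  · change e i ∈ _
    rw [he]
    exact Set.insert_subset_insert (fun s hs => hs.1) (hbT (σ.symm i).2)
  · ext i
    change e i ⬝ᵥ w = _
    by_cases hi : i = σ ⟨v₀, hvb rfl⟩
    · rw [he, hi]; simp [dotProduct_comm]
    · rw [Pi.single_eq_of_ne hi, he]
      rcases hbT (σ.symm i).2 with h | h
      · exact absurd ((Equiv.symm_apply_eq σ).1 (Subtype.ext h)) hi
      · rw [dotProduct_comm]; exact h.2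

theorem exists_int_eq_det {N : ℕ} (M : Matrix (Fin N) (Fin N) ℝ)
    (hM : ∀ i j, ∃ a : ℤ, M i j = a) : ∃ a : ℤ, M.det = a := by
  choose a ha using hM
  refine ⟨(Matrix.of a).det, ?_⟩
  rw [Int.cast_det]
  congr 1
  ext i j
  simp [ha]

/-- A non-singular system with entries in `{-1, 0, 1}` and a multiple of a unit vector on the
right-hand side has, up to a positive factor, an integral solution bounded by Hadamard. -/
theorem exists_int_multiple_of_nonsingular {N : ℕ} (M : Matrix (Fin N) (Fin N) ℝ) (i₀ : Fin N)
    (w : Fin N → ℝ) (δ : ℝ) (hδ : 0 < δ) (hdet : M.det ≠ 0) (hw : M *ᵥ w = Pi.single i₀ δ)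
    (hM : ∀ i j, ∃ a : ℤ, M i j = a ∧ |a| ≤ 1) :
    ∃ (q : Fin N → ℤ) (ρ : ℝ), 0 < ρ ∧ (∀ j, (q j : ℝ) = ρ * w j) ∧
      ∀ j, |(q j : ℝ)| ≤ √(N : ℝ) ^ N := by
  have hentry : ∀ j i l, ∃ a : ℤ, (M.updateCol j (Pi.single i₀ 1)) i l = a ∧ |a| ≤ 1 := by
    intro j i l
    rw [Matrix.updateCol_apply]
    split_ifs
    · by_cases h : i = i₀
      · subst h; exact ⟨1, by simp⟩
      · exact ⟨0, by simp [h]⟩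
    · exact hM i l
  have hint : ∀ j, ∃ a : ℤ, M.cramer (Pi.single i₀ 1) j = a := fun j => by
    rw [Matrix.cramer_apply]
    exact exists_int_eq_det _ fun i l => (hentry j i l).imp fun _ h => h.1
  have hbound : ∀ j, |M.cramer (Pi.single i₀ 1) j| ≤ √(N : ℝ) ^ N := fun j => by
    rw [Matrix.cramer_apply]
    refine abs_det_le_sqrt_pow _ fun i l => ?_
    obtain ⟨a, ha, ha1⟩ := hentry j i l
    rw [ha]
    exact_mod_cast ha1
  have hsol : ∀ j, δ * M.cramer (Pi.single i₀ 1) j = M.det * w j := fun j => by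
    have h1 : M.cramer (M *ᵥ w) = M.det • w := by
      rw [Matrix.cramer_eq_adjugate_mulVec, Matrix.mulVec_mulVec, Matrix.adjugate_mul,
        Matrix.smul_mulVec, Matrix.one_mulVec]
    have h2 : (Pi.single i₀ δ : Fin N → ℝ) = δ • Pi.single i₀ 1 := by
      rw [← Pi.single_smul]; simp
    rw [hw, h2, map_smul] at h1
    simpa using congrFun h1 j
  choose p hp using hint
  -- The sign of the Cramer solution is chosen to make the factor `|det M| / δ` positive.
  rcases lt_or_gt_of_ne hdet with h | h
  · refine ⟨fun j => -p j, -M.det / δ, div_pos (by linarith) hδ, fun j => ?_, fun j => ?_⟩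
    · have := hsol j
      rw [hp] at this
      push_cast
      field_simp
      linarith
    · push_cast; rw [abs_neg, ← hp]; exact hbound j
  · refine ⟨p, M.det / δ, div_pos h hδ, fun j => ?_, fun j => ?_⟩
    · have := hsol j
      rw [hp] at this
      field_simp
      linarith
    · rw [← hp]; exact hbound j

theorem finite_cube01 (n : ℕ) : (cube01 n).Finite := by
  refine (Set.Finite.pi' (t := fun _ : Fin n => ({0, 1} : Set ℝ))
    (fun _ => Set.toFinite _)).subset ?_
  intro x hx i
  simpa using hx i

/-- Distinct 0/1 points are strictly separated by a vertex functional of the cube. -/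
theorem vertex_functional_lt {n : ℕ} {x y : Fin n → ℝ} (hx : x ∈ cube01 n) (hy : y ∈ cube01 n)
    (hne : x ≠ y) : (fun i => 2 * y i - 1) ⬝ᵥ x < (fun i => 2 * y i - 1) ⬝ᵥ y := by
  obtain ⟨j, hj⟩ := Function.ne_iff.1 hne
  refine Finset.sum_lt_sum (fun i _ => ?_) ⟨j, Finset.mem_univ _, ?_⟩
  · rcases hx i with h | h <;> rcases hy i with h' | h' <;> simp only [h, h'] <;> norm_num
  · rcases hx j with h | h <;> rcases hy j with h' | h' <;> simp [h, h'] at hj ⊢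

/-- A 0/1 point outside `X` violates an integral inequality with small coefficients that is
valid and tight for `X`. -/
theorem exists_int_separating {n : ℕ} (X : Set (Fin n → ℝ)) (hX : X ⊆ cube01 n)
    (hne : X.Nonempty) (x₀ : Fin n → ℝ) (hx₀ : x₀ ∈ cube01 n) (hx₀X : x₀ ∉ X) :
    ∃ (a : Fin n → ℤ) (b : ℤ), (∀ j, |(a j : ℝ)| ≤ Delta n) ∧ |(b : ℝ)| ≤ Delta n ∧
      (∀ x ∈ X, (fun j => (a j : ℝ)) ⬝ᵥ x ≤ b) ∧ (∃ x ∈ X, (fun j => (a j : ℝ)) ⬝ᵥ x = b) ∧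
      (b : ℝ) + 1 ≤ (fun j => (a j : ℝ)) ⬝ᵥ x₀ := by
  classical
  have hXf := (finite_cube01 n).subset hX
  -- The right-hand side becomes coordinate `0` of `w`; the systems thus have order `n + 1`, whence
  -- `Δ`.
  let H : (Fin n → ℝ) → Fin (n + 1) → ℝ := fun x => Fin.cons (-1) x
  have hH : ∀ (w : Fin (n + 1) → ℝ) x, w ⬝ᵥ H x = (fun j => w j.succ) ⬝ᵥ x - w 0 := fun w x => by
    simp [H, dotProduct, Fin.sum_univ_succ]; ring
  let S : Set (Fin (n + 1) → ℝ) := H '' X ∪ Set.range (fun j => Pi.single j 1)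
  let a₀ : Fin n → ℝ := fun i => 2 * x₀ i - 1
  obtain ⟨xm, hxm, hmax⟩ := Set.exists_max_image X (fun x => a₀ ⬝ᵥ x) hXf hne
  obtain ⟨w, hw1, hw2, hw3, hw4⟩ := exists_separating_basic S (H '' X)
    ((hXf.image _).union (Set.finite_range _)) Set.subset_union_left (fun j => Or.inr ⟨j, rfl⟩)
    (H x₀) (Fin.cons (a₀ ⬝ᵥ xm) a₀)
    (by rintro _ ⟨x, hx, rfl⟩; rw [hH]; simpa using hmax x hx)
    ⟨H xm, ⟨xm, hxm, rfl⟩, by rw [hH]; simp⟩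
    (by
      rw [hH]
      simpa using vertex_functional_lt (hX hxm) hx₀ (fun h => hx₀X (h ▸ hxm)))
  obtain ⟨M, i₀, hdet, hrow, hMw⟩ := exists_nonsingular_system S (H x₀) w hw3 hw4
  have hcube : ∀ x ∈ cube01 n, ∀ j, ∃ a : ℤ, H x j = a ∧ |a| ≤ 1 := fun x hx j => by
    refine Fin.cases ⟨-1, by simp [H]⟩ (fun j => ?_) j
    rcases hx j with h | h
    · exact ⟨0, by simp [H, h]⟩
    · exact ⟨1, by simp [H, h]⟩
  obtain ⟨q, ρ, hρ, hq, hqb⟩ := exists_int_multiple_of_nonsingular M i₀ w _ hw3 hdet hMw (by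
    intro i j
    rcases hrow i with h | ⟨x, hx, h⟩ | ⟨l, h⟩
    · rw [h]; exact hcube x₀ hx₀ j
    · rw [← h]; exact hcube x (hX hx) j
    · rw [← h]
      by_cases hjl : j = l
      · subst hjl; exact ⟨1, by simp⟩
      · exact ⟨0, by simp [hjl]⟩)
  have hval : ∀ x, (fun j : Fin n => (q j.succ : ℝ)) ⬝ᵥ x - q 0 = ρ * (w ⬝ᵥ H x) := fun x => by
    rw [hH, mul_sub, ← smul_eq_mul, ← smul_dotProduct, hq]
    congr 2
    ext j
    simp [hq]
  have hΔ : √((n + 1 : ℕ) : ℝ) ^ (n + 1) = Delta n := by simp [Delta]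
  rw [hΔ] at hqb
  refine ⟨fun j => q j.succ, q 0, fun j => hqb _, hqb _, fun x hx => ?_, ?_, ?_⟩
  · have := mul_nonpos_of_nonneg_of_nonpos hρ.le (hw1 _ ⟨x, hx, rfl⟩)
    rw [← hval] at this
    linarith
  · obtain ⟨_, ⟨x, hx, rfl⟩, h0⟩ := hw2
    refine ⟨x, hx, ?_⟩
    have := hval x
    rw [h0, mul_zero] at this
    linarith
  · have := mul_pos hρ hw3
    rw [← hval] at this
    have hi : ∃ z : ℤ, (fun j : Fin n => (q j.succ : ℝ)) ⬝ᵥ x₀ = z := by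
      have : ∀ j, ∃ z : ℤ, x₀ j = z := fun j => by
        rcases hx₀ j with h | h
        · exact ⟨0, by simp [h]⟩
        · exact ⟨1, by simp [h]⟩
      choose z hz using this
      exact ⟨∑ j, q j.succ * z j, by simp [dotProduct, hz]⟩
    obtain ⟨z, hz⟩ := hi
    rw [hz] at this ⊢
    have : q 0 < z := by exact_mod_cast sub_pos.1 this
    exact_mod_cast Int.add_one_le_iff.2 this

/-! ### Slack factorizations and their scaling -/

/-- A subfamily as in `exists_subfamily_coeff_le_one`, padded by zero vectors. -/
theorem exists_padded_subfamily_coeff_le_one {E ι : Type*} [AddCommGroup E] [Module ℝ E]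
    [Module.Finite ℝ E] [Finite ι] (v : ι → E) {K : ℕ} (hK : Module.finrank ℝ E ≤ K) :
    ∃ g : Fin K → Option ι, ∀ l, ∃ c : Fin K → ℝ,
      (∀ i, |c i| ≤ 1) ∧ v l = ∑ i, c i • (g i).elim 0 v := by
  obtain ⟨f, hf⟩ := exists_subfamily_coeff_le_one v
  obtain ⟨t, rfl⟩ := Nat.exists_eq_add_of_le
    ((Submodule.finrank_le (Submodule.span ℝ (Set.range v))).trans hK)
  refine ⟨Fin.append (fun i => some (f i)) (fun _ => none), fun l => ?_⟩
  obtain ⟨c, hc, hv⟩ := hf l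
  refine ⟨Fin.append c 0, fun i => ?_, ?_⟩
  · refine Fin.addCases (fun i => ?_) (fun i => ?_) i <;> simp [hc]
  · simp [Fin.sum_univ_add, hv]

/-- Scaling the largest `f i` to exactly `Δ` leaves at most `Δ` for each `g k`; if `f` vanishes, any
large `s` works. -/
theorem exists_balancing_scale {ι κ : Type*} [Finite ι] [Finite κ] (f : ι → ℝ) (g : κ → ℝ)
    (hf : ∀ i, 0 ≤ f i) {Δ : ℝ} (hΔ : 0 < Δ)
    (h : ∀ i k, f i * g k ≤ Δ ^ 2) :
    ∃ s : ℝ, 0 < s ∧ (∀ i, f i * s ≤ Δ) ∧ ∀ k, g k / s ≤ Δ := by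
  by_cases h0 : ∃ i, f i ≠ 0
  · obtain ⟨i₁, hi₁⟩ := h0
    have : Nonempty ι := ⟨i₁⟩
    obtain ⟨i₀, hi₀⟩ := Finite.exists_max f
    have hpos : 0 < f i₀ := (lt_of_le_of_ne (hf i₁) hi₁.symm).trans_le (hi₀ i₁)
    refine ⟨Δ / f i₀, by positivity, fun i => ?_, fun k => ?_⟩
    · rw [mul_div_assoc', div_le_iff₀ hpos]
      nlinarith [hi₀ i]
    · rw [div_le_iff₀ (by positivity), mul_div_assoc', le_div_iff₀ hpos]
      nlinarith [h i₀ k]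
  · push Not at h0
    obtain ⟨B, hB⟩ := (Set.finite_range g).bddAbove
    refine ⟨|B| / Δ + 1, by positivity, fun i => by simp [h0, hΔ.le], fun k => ?_⟩
    rw [div_le_iff₀ (by positivity), mul_add, mul_div_cancel₀ _ hΔ.ne']
    linarith [hB ⟨k, rfl⟩, le_abs_self B]

theorem natCast_add_one_le_Delta (n : ℕ) : (n : ℝ) + 1 ≤ Delta n := by
  rcases Nat.eq_zero_or_pos n with rfl | hn
  · simp [Delta]
  · have h1 : (1 : ℝ) ≤ √((n : ℝ) + 1) := by
      rw [Real.one_le_sqrt]; linarith [Nat.cast_nonneg (α := ℝ) n]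
    calc (n : ℝ) + 1 = √((n : ℝ) + 1) ^ 2 := (Real.sq_sqrt (by positivity)).symm
      _ ≤ Delta n := pow_le_pow_right₀ h1 (by omega)

/-- The slacks of tight valid inequalities factor through an extended formulation. -/
theorem HasExtendedFormulation.exists_slack_factorization {n r : ℕ} {X : Set (Fin n → ℝ)}
    (h : HasExtendedFormulation (convexHull ℝ X) r) {ι : Type*} (a : ι → Fin n → ℝ) (b : ι → ℝ)
    (hval : ∀ l, ∀ x ∈ X, a l ⬝ᵥ x ≤ b l) (htight : ∀ l, ∃ x ∈ X, a l ⬝ᵥ x = b l) :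
    ∃ (u : ι → Fin r → ℝ) (y : X → Fin r → ℝ), (∀ l j, 0 ≤ u l j) ∧ (∀ x j, 0 ≤ y x j) ∧
      ∀ l (x : X), a l ⬝ᵥ (x : Fin n → ℝ) + u l ⬝ᵥ y x = b l := by
  obtain ⟨m, k, C, c, D, d, p, hp⟩ := h
  have hz : ∀ x : X, ∃ z, (C *ᵥ z ≤ c ∧ D *ᵥ z = d) ∧ p z = x := fun x => by
    have : (x : Fin n → ℝ) ∈ p '' {z | C *ᵥ z ≤ c ∧ D *ᵥ z = d} :=
      hp ▸ subset_convexHull ℝ X x.2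
    exact this
  choose z hzQ hzp using hz
  have hrow : ∀ l, ∃ u : Fin r → ℝ, (∀ j, 0 ≤ u j) ∧
      ∀ x : X, a l ⬝ᵥ (x : Fin n → ℝ) + u ⬝ᵥ (c - C *ᵥ z x) = b l := fun l => by
    obtain ⟨xt, hxt, hxtb⟩ := htight l
    let φ : (Fin n → ℝ) →ₗ[ℝ] ℝ := dotProductBilin ℝ ℝ (a l)
    have hφ : ∀ x, φ x = a l ⬝ᵥ x := fun x => rfl
    have hhull : convexHull ℝ X ⊆ {x | φ x ≤ b l} :=
      convexHull_min (fun x hx => hval l x hx) (convex_halfSpace_le φ.isLinear _)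
    obtain ⟨u, ε, hu, hε, hs⟩ := exists_slack_eq_combination C c D d (φ ∘ₗ p) (b l)
      ⟨z ⟨xt, hxt⟩, hzQ _⟩ (fun w hC hD => hhull (hp ▸ ⟨w, ⟨hC, hD⟩, rfl⟩))
    have hs' : ∀ x : X, b l - a l ⬝ᵥ (x : Fin n → ℝ) = u ⬝ᵥ (c - C *ᵥ z x) + ε := fun x => by
      have := hs (z x) (hzQ x).2
      rwa [LinearMap.comp_apply, hzp, hφ] at this
    have hnn : 0 ≤ u ⬝ᵥ (c - C *ᵥ z ⟨xt, hxt⟩) :=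
      Finset.sum_nonneg fun j _ => mul_nonneg (hu j) (sub_nonneg.2 ((hzQ ⟨xt, hxt⟩).1 j))
    have hε0 : ε = 0 := by
      have := hs' ⟨xt, hxt⟩
      simp only [hxtb] at this
      linarith
    exact ⟨u, hu, fun x => by linarith [hs' x]⟩
  choose u hu hux using hrow
  exact ⟨u, fun x => c - C *ᵥ z x, hu, fun x j => sub_nonneg.2 ((hzQ x).1 j), hux⟩

/-- A factorization of a bounded slack matrix can be scaled to have bounded factors. -/
theorem exists_scaled_factorization {ι κ : Type*} [Finite ι] [Finite κ] {r : ℕ}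
    (u : ι → Fin r → ℝ) (y : κ → Fin r → ℝ) (hu : ∀ l j, 0 ≤ u l j) (hy : ∀ x j, 0 ≤ y x j)
    {Δ : ℝ} (hΔ : 0 < Δ) (hle : ∀ l x, u l ⬝ᵥ y x ≤ Δ ^ 2) :
    ∃ (u' : ι → Fin r → ℝ) (y' : κ → Fin r → ℝ), (∀ l j, u' l j ∈ Set.Icc 0 Δ) ∧
      (∀ x j, y' x j ∈ Set.Icc 0 Δ) ∧ ∀ l x, u' l ⬝ᵥ y' x = u l ⬝ᵥ y x := by
  have hs := fun j => exists_balancing_scale (fun l => u l j) (fun x => y x j)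
    (fun l => hu l j) hΔ (fun l x => (Finset.single_le_sum
      (f := fun j => u l j * y x j) (fun i _ => mul_nonneg (hu l i) (hy x i))
      (Finset.mem_univ j)).trans (hle l x))
  choose s hs0 hsu hsy using hs
  refine ⟨fun l j => u l j * s j, fun x j => y x j / s j,
    fun l j => ⟨mul_nonneg (hu l j) (hs0 j).le, hsu j l⟩,
    fun x j => ⟨div_nonneg (hy x j) (hs0 j).le, hsy j x⟩, fun l x => ?_⟩
  refine Finset.sum_congr rfl fun j _ => ?_
  have := (hs0 j).ne'
  field_simp

/-! ### Rounding and assembly -/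

theorem exists_nat_mul_le_lt {η u : ℝ} (hη : 0 < η) (hu : 0 ≤ u) :
    ∃ k : ℕ, k * η ≤ u ∧ u < k * η + η := by
  refine ⟨⌊u / η⌋₊, ?_, ?_⟩
  · rw [← le_div_iff₀ hη]; exact Nat.floor_le (by positivity)
  · have := Nat.lt_floor_add_one (u / η)
    rw [div_lt_iff₀ hη] at this
    linarith

theorem abs_sub_dotProduct_le {r : ℕ} {u u' y : Fin r → ℝ} {η Δ : ℝ} (hη : 0 ≤ η)
    (hu : ∀ j, |u j - u' j| ≤ η) (hy : ∀ j, y j ∈ Set.Icc 0 Δ) :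
    |u ⬝ᵥ y - u' ⬝ᵥ y| ≤ r * (η * Δ) := by
  rw [← sub_dotProduct]
  calc |(u - u') ⬝ᵥ y| ≤ ∑ j, |(u - u') j * y j| := Finset.abs_sum_le_sum_abs _ _
    _ ≤ ∑ _j : Fin r, η * Δ := Finset.sum_le_sum fun j _ => by
        rw [abs_mul, abs_of_nonneg (hy j).1]
        exact mul_le_mul (hu j) (hy j).2 (hy j).1 hη
    _ = r * (η * Δ) := by simp

theorem mainTheorem2 (n : ℕ) (X : Set (Fin n → ℝ)) (hX : X ⊆ cube01 n) (hne : X.Nonempty)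
    (r : ℕ) (hr : r = xc (convexHull ℝ X)) :
    ∃ (A : Matrix (Fin (n + r)) (Fin n) ℤ) (U : Matrix (Fin (n + r)) (Fin r) ℝ)
      (b : Fin (n + r) → ℤ),
      (∀ i j, ∃ k : ℕ, U i j = (k : ℝ) * (1 / (4 * (r : ℝ) * ((n : ℝ) + r) * Delta n))) ∧
      (∀ i j, |(A i j : ℝ)| ≤ Delta n) ∧
      (∀ i, |(b i : ℝ)| ≤ Delta n) ∧
      (∀ i j, |U i j| ≤ Delta n) ∧
      X = {x | x ∈ cube01 n ∧ ∃ y : Fin r → ℝ, (∀ j, y j ∈ Set.Icc 0 (Delta n)) ∧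
        ‖A.map (Int.cast : ℤ → ℝ) *ᵥ x + U *ᵥ y - (fun i => (b i : ℝ))‖
          ≤ 1 / (4 * ((n : ℝ) + r))} := by
  have hxc : HasExtendedFormulation (convexHull ℝ X) r := by
    rw [hr]; exact Nat.sInf_mem (exists_hasExtendedFormulation X hX)
  have hΔ1 := natCast_add_one_le_Delta n
  have hn0 : (0 : ℝ) ≤ n := Nat.cast_nonneg n
  have hr0 : (0 : ℝ) ≤ r := Nat.cast_nonneg r
  have hΔ : 0 < Delta n := by linarith
  set Δ := Delta n
  have : Finite X := (finite_cube01 n).subset hX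
  let ι := {x // x ∈ cube01 n ∧ x ∉ X}
  have : Finite ι := (finite_cube01 n).subset (fun x hx => hx.1 : {x | x ∈ cube01 n ∧ x ∉ X} ⊆ _)
  choose a b ha hb hval htight hviol using
    fun l : ι => exists_int_separating X hX hne l.1 l.2.1 l.2.2
  obtain ⟨u₀, y₀, hu₀, hy₀, hfac₀⟩ := hxc.exists_slack_factorization
    (fun l j => (a l j : ℝ)) (fun l => (b l : ℝ)) hval htight
  -- A slack is at most `Δ + nΔ`, and `n + 1 ≤ Δ`.
  have hslack : ∀ l x, u₀ l ⬝ᵥ y₀ x ≤ Δ ^ 2 := fun l x => by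
    have h1 : -((fun j => (a l j : ℝ)) ⬝ᵥ (x : Fin n → ℝ)) ≤ n * Δ := by
      rw [← neg_dotProduct]
      calc _ ≤ ∑ _j : Fin n, Δ := Finset.sum_le_sum fun j _ => by
            have h := neg_le_of_abs_le (ha l j)
            rcases hX x.2 j with hx | hx <;> simp only [hx, Pi.neg_apply] <;> linarith
        _ = n * Δ := by simp
    have h2 := hfac₀ l x
    have h3 := le_of_abs_le (hb l)
    nlinarith
  obtain ⟨u, Y, hu, hY, huY⟩ := exists_scaled_factorization u₀ y₀ hu₀ hy₀ hΔ hslack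
  have hfac : ∀ l (x : X), (fun j => (a l j : ℝ)) ⬝ᵥ (x : Fin n → ℝ) + u l ⬝ᵥ Y x = b l :=
    fun l x => by rw [huY, hfac₀]
  let v : ι → (Fin n → ℝ) × (Fin r → ℝ) := fun l => (fun j => (a l j : ℝ), u l)
  obtain ⟨g, hg⟩ := exists_padded_subfamily_coeff_le_one v (K := n + r) (by simp)
  let A : Matrix (Fin (n + r)) (Fin n) ℤ := fun i => (g i).elim 0 a
  let β : Fin (n + r) → ℤ := fun i => (g i).elim 0 b
  let W : Fin (n + r) → Fin r → ℝ := fun i => (g i).elim 0 u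
  have hA : ∀ i j, |(A i j : ℝ)| ≤ Δ := fun i j => by
    simp only [A]; cases g i
    · simp [hΔ.le]
    · exact ha _ j
  have hβ : ∀ i, |(β i : ℝ)| ≤ Δ := fun i => by
    simp only [β]; cases g i
    · simp [hΔ.le]
    · exact hb _
  have hW : ∀ i j, W i j ∈ Set.Icc 0 Δ := fun i j => by
    simp only [W]; cases g i
    · simp [hΔ.le]
    · exact hu _ j
  have hrow : ∀ i, (g i).elim 0 v = (fun j => (A i j : ℝ), W i) := fun i => by
    simp only [A, W, v]; cases g i
    · ext <;> simp
    · rfl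
  have hfacW : ∀ i (x : X), (fun j => (A i j : ℝ)) ⬝ᵥ (x : Fin n → ℝ) + W i ⬝ᵥ Y x = β i :=
    fun i x => by
      simp only [A, W, β]; cases g i
      · simp [dotProduct]
      · exact hfac _ x
  set η : ℝ := 1 / (4 * (r : ℝ) * ((n : ℝ) + r) * Δ) with hη
  have hη0 : 0 ≤ η := by positivity
  have hround : ∀ i j, ∃ k : ℕ, k * η ≤ W i j ∧ W i j < k * η + η := fun i j => by
    have : (0 : ℝ) < r := by exact_mod_cast j.pos
    exact exists_nat_mul_le_lt (by positivity) (hW i j).1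
  choose k hk1 hk2 using hround
  let U : Matrix (Fin (n + r)) (Fin r) ℝ := fun i j => k i j * η
  have hUW : ∀ i (y : Fin r → ℝ), (∀ j, y j ∈ Set.Icc 0 Δ) →
      |W i ⬝ᵥ y - U i ⬝ᵥ y| ≤ 1 / (4 * ((n : ℝ) + r)) := fun i y hy => by
    refine (abs_sub_dotProduct_le hη0 (fun j => ?_) hy).trans ?_
    · rw [abs_le]
      constructor <;> linarith [hk1 i j, hk2 i j]
    · rcases hr0.eq_or_lt with h0 | hrpos
      · rw [← h0]; simp
      · rw [hη]
        apply le_of_eq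
        field_simp
  refine ⟨A, U, β, fun i j => ⟨k i j, rfl⟩, hA, hβ, fun i j => ?_, ?_⟩
  · have h0 : 0 ≤ U i j := mul_nonneg (Nat.cast_nonneg _) hη0
    rw [abs_of_nonneg h0]
    exact (hk1 i j).trans (hW i j).2
  have hnorm : (0 : ℝ) ≤ 1 / (4 * ((n : ℝ) + r)) := by positivity
  ext x
  constructor
  · intro hx
    refine ⟨hX hx, Y ⟨x, hx⟩, hY _, (pi_norm_le_iff_of_nonneg hnorm).2 fun i => ?_⟩
    change |(fun j => (A i j : ℝ)) ⬝ᵥ x + U i ⬝ᵥ Y ⟨x, hx⟩ - β i| ≤ _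
    rw [abs_sub_comm, ← hfacW i ⟨x, hx⟩, add_sub_add_left_eq_sub]
    exact hUW i _ (hY ⟨x, hx⟩)
  · rintro ⟨hxc, y, hy, hle⟩
    by_contra hxX
    obtain ⟨x₁, hx₁⟩ := hne
    let l : ι := ⟨x, hxc, hxX⟩
    obtain ⟨c, hc, hv⟩ := hg l
    -- Every row is exact at `(x₁, Y x₁)`, so differences from this point recover the right-hand
    -- sides. This is why `b` is not a coordinate of `v` and `n + r` rows suffice.
    let Φ : (Fin n → ℝ) × (Fin r → ℝ) →ₗ[ℝ] ℝ :=
      ((dotProductBilin ℝ ℝ).flip (x - x₁)).coprod ((dotProductBilin ℝ ℝ).flip (y - Y ⟨x₁, hx₁⟩))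
    have hΦ : ∀ α υ, Φ (α, υ) = α ⬝ᵥ x + υ ⬝ᵥ y - (α ⬝ᵥ x₁ + υ ⬝ᵥ Y ⟨x₁, hx₁⟩) := fun α υ => by
      change α ⬝ᵥ (x - x₁) + υ ⬝ᵥ (y - Y ⟨x₁, hx₁⟩) = _
      rw [dotProduct_sub, dotProduct_sub]; ring
    have hlow : 1 ≤ Φ (v l) := by
      have h1 := hviol l
      have h2 : 0 ≤ u l ⬝ᵥ y := Finset.sum_nonneg fun j _ => mul_nonneg (hu l j).1 (hy j).1
      rw [hΦ, hfac l ⟨x₁, hx₁⟩]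
      change (b l : ℝ) + 1 ≤ (fun j => (a l j : ℝ)) ⬝ᵥ x at h1
      linarith
    have hterm : ∀ i, c i * Φ ((g i).elim 0 v) ≤ 2 * (1 / (4 * ((n : ℝ) + r))) := fun i => by
      have h1 := (pi_norm_le_iff_of_nonneg hnorm).1 hle i
      have h2 := hUW i y hy
      rw [Real.norm_eq_abs] at h1
      change |(fun j => (A i j : ℝ)) ⬝ᵥ x + U i ⬝ᵥ y - β i| ≤ _ at h1
      rw [hrow, hΦ, hfacW i ⟨x₁, hx₁⟩]
      have h3 : |(fun j => (A i j : ℝ)) ⬝ᵥ x + W i ⬝ᵥ y - β i|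
          ≤ 2 * (1 / (4 * ((n : ℝ) + r))) := by
        rw [abs_le] at *
        constructor <;> linarith
      calc _ ≤ |c i * ((fun j => (A i j : ℝ)) ⬝ᵥ x + W i ⬝ᵥ y - β i)| := le_abs_self _
        _ = |c i| * |(fun j => (A i j : ℝ)) ⬝ᵥ x + W i ⬝ᵥ y - β i| := abs_mul _ _
        _ ≤ 1 * |(fun j => (A i j : ℝ)) ⬝ᵥ x + W i ⬝ᵥ y - β i| := by gcongr; exact hc i
        _ ≤ _ := by rw [one_mul]; exact h3
    have hup : Φ (v l) ≤ 1 / 2 := by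
      rw [hv, map_sum]
      calc ∑ i, Φ (c i • (g i).elim 0 v) ≤ ∑ _i : Fin (n + r), 2 * (1 / (4 * ((n : ℝ) + r))) :=
            Finset.sum_le_sum fun i _ => by rw [map_smul, smul_eq_mul]; exact hterm i
        _ = ((n : ℝ) + r) / ((n : ℝ) + r) * (1 / 2) := by
            simp only [Finset.sum_const, Finset.card_univ, Fintype.card_fin, nsmul_eq_mul,
              Nat.cast_add, one_div, mul_inv]
            ring
        -- Only an inequality, since the quotient is `0` when `n + r = 0`.
        _ ≤ 1 / 2 := by linarith [div_self_le_one ((n : ℝ) + r)]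
    linarith
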